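/- Let $d\ge 2$ be an integer, $1\le p\le\infty$ and $r>0$, and let $m\in\mathbb N$ be determined by $m-1\le r<m$. For $f:\mathbb R^d\to\mathbb C$, $j\in\{1,\dots,d\}$ and $h\in\mathbb R$ put $$\Delta^m_{h,j}f(x)=\sum_{\ell=0}^m(-1)^{m-\ell}\binom m\ell f(x_1,\dots,x_{j-1},x_j+\ell h,x_{j+1},\dots,x_d).$$ For $e\subset\{1,\dots,d\}$ and $h\in\mathbb R^d$ put $\Delta^{m,e}_h=\prod_{i\in e}\Delta^m_{h_i,i}$ (the identity if $e=\emptyset$), and for $t\in[0,1]^d$ $$\omega^e_m(f,t)_p=\sup_{|h_i|<t_i,\ i\in e}\|\Delta^{m,e}_hf\|_{L_p(\mathbb R^d)}.$$ Let $\mathbb N_0^d(e)$ be the set of $k\in\mathbb N_0^d$ with $k_i=0$ for all $i\notin e$, and write $|k|_1=k_1+\dots+k_d$ and $2^{-k}=(2^{-k_1},\dots,2^{-k_d})$. The Besov space of dominating mixed smoothness $S^r_{p,p}B(\mathbb R^d)$ consists of all $f\in L_p(\mathbb R^d)$ for which $$\|f|S^r_{p,p}B(\mathbb R^d)\|=\sum_{e\subset\{1,\dots,d\}}\Big(\sum_{k\in\mathbb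 N_0^d(e)}2^{r|k|_1p}\,\omega^e_m(f,2^{-k})_p^p\Big)^{1/p}$$ is finite (with $\sup_{k\in\mathbb N_0^d(e)}2^{r|k|_1}\omega^e_m(f,2^{-k})_\infty$ in place of the inner expression if $p=\infty$); the norm is $\infty$ for functions in $L_p(\mathbb R^d)$ outside the space. Let $C(\mathbb R^d)$ be the space of bounded continuous functions $\mathbb R^d\to\mathbb C$. Then there exists no constant $C>0$ such that $$\|fg|S^r_{p,p}B(\mathbb R^d)\|\le C\big(\|f|S^r_{p,p}B(\mathbb R^d)\|\,\|g\|_{L_\infty(\mathbb R^d)}+\|f\|_{L_\infty(\mathbb R^d)}\,\|g|S^r_{p,p}B(\mathbb R^d)\|\big)$$ holds for all $f,g\in S^r_{p,p}B(\mathbb R^d)\cap C(\mathbb R^d)$. -/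

import Mathlib

open MeasureTheory
open scoped ENNReal BoundedContinuousFunction

noncomputable section

/-- The `m`-th order difference in direction `j` with step `h`, as an operator on complex-valued
functions on `ℝ^d`:
`Δ^m_{h,j} f (x) = ∑_{ℓ=0}^m (-1)^(m-ℓ) (m choose ℓ) f (x₁, …, x_j + ℓ h, …, x_d)`. -/
def directionalDiff {d : ℕ} (m : ℕ) (h : ℝ) (j : Fin d) :
    Module.End ℂ ((Fin d → ℝ) → ℂ) where
  toFun f := fun x => ∑ l ∈ Finset.range (m + 1),
    (-1 : ℂ) ^ (m - l) * (m.choose l : ℂ) * f (Function.update x j (x j + l * h))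
  map_add' f g := by
    funext x
    simp [mul_add, Finset.sum_add_distrib]
  map_smul' c f := by
    funext x
    simp only [Pi.smul_apply, smul_eq_mul, RingHom.id_apply, Finset.mul_sum]
    exact Finset.sum_congr rfl fun _ _ => by ring

theorem directionalDiff_commute {d : ℕ} (m : ℕ) (h : Fin d → ℝ) {i j : Fin d} (hij : i ≠ j) :
    Commute (directionalDiff m (h i) i) (directionalDiff m (h j) j) := by
  refine LinearMap.ext fun f => funext fun x => ?_
  change (∑ a ∈ Finset.range (m + 1), _ * (∑ b ∈ Finset.range (m + 1), _)) =
    ∑ b ∈ Finset.range (m + 1), _ * (∑ a ∈ Finset.range (m + 1), _)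
  simp only [Finset.mul_sum]
  rw [Finset.sum_comm]
  refine Finset.sum_congr rfl fun b _ => Finset.sum_congr rfl fun a _ => ?_
  rw [Function.update_of_ne hij, Function.update_of_ne hij.symm,
    Function.update_comm hij]
  ring

theorem directionalDiff_pairwise {d : ℕ} (m : ℕ) (e : Finset (Fin d)) (h : Fin d → ℝ) :
    (e : Set (Fin d)).Pairwise
      (Function.onFun Commute fun i => directionalDiff m (h i) i) := by
  intro i _ j _ hij
  exact directionalDiff_commute m h hij

/-- The mixed difference `Δ_h^{m,e} = ∏_{i ∈ e} Δ^m_{h_i,i}` (product of commuting operators,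
equal to the identity for `e = ∅`). -/
def mixedDiff {d : ℕ} (m : ℕ) (e : Finset (Fin d)) (h : Fin d → ℝ) :
    Module.End ℂ ((Fin d → ℝ) → ℂ) :=
  e.noncommProd (fun i => directionalDiff m (h i) i)
    (directionalDiff_pairwise m e h)

/-- The mixed modulus of smoothness
`ω_m^e (f, t)_p = sup {‖Δ_h^{m,e} f‖_{L_p(ℝ^d)} : |h_i| < t_i for i ∈ e}`.
The measure `volume` on `Fin d → ℝ` is Lebesgue measure on `ℝ^d`. -/
def mixedModulus {d : ℕ} (m : ℕ) (e : Finset (Fin d)) (p : ℝ≥0∞)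
    (f : (Fin d → ℝ) → ℂ) (t : Fin d → ℝ) : ℝ≥0∞ :=
  ⨆ (h : Fin d → ℝ) (_ : ∀ i ∈ e, |h i| < t i), eLpNorm (mixedDiff m e h f) p volume

/-- The multi-indices `k ∈ ℕ₀^d` with `k_i = 0` for `i ∉ e`. -/
def multiIndices {d : ℕ} (e : Finset (Fin d)) : Set (Fin d → ℕ) :=
  {k | ∀ i, i ∉ e → k i = 0}

/-- The contribution of `e ⊆ [d]` to the Besov norm:
`(∑_{k ∈ ℕ₀^d(e)} 2^{r |k|₁ p} ω_m^e (f, 2^{-k})_p^p)^{1/p}`,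
or `sup_{k ∈ ℕ₀^d(e)} 2^{r |k|₁} ω_m^e (f, 2^{-k})_∞` if `p = ∞`. -/
def besovPart {d : ℕ} (r : ℝ) (p : ℝ≥0∞) (m : ℕ) (e : Finset (Fin d))
    (f : (Fin d → ℝ) → ℂ) : ℝ≥0∞ :=
  if p = ∞ then
    ⨆ k : multiIndices e, (2 : ℝ≥0∞) ^ (r * ∑ i, (k.1 i : ℝ)) *
      mixedModulus m e p f (fun i => ((2 : ℝ) ^ k.1 i)⁻¹)
  else
    (∑' k : multiIndices e, (2 : ℝ≥0∞) ^ (r * (∑ i, (k.1 i : ℝ)) * p.toReal) *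
      mixedModulus m e p f (fun i => ((2 : ℝ) ^ k.1 i)⁻¹) ^ p.toReal) ^ (1 / p.toReal)

/-- The (extended) norm `‖f | S^r_{p,p}B(ℝ^d)‖` of the Besov space of dominating mixed smoothness.
The order of the differences is `m = ⌊r⌋ + 1`, the unique `m ∈ ℕ` with `m - 1 ≤ r < m`. -/
def besovNorm {d : ℕ} (r : ℝ) (p : ℝ≥0∞) (f : (Fin d → ℝ) → ℂ) : ℝ≥0∞ :=
  ∑ e : Finset (Fin d), besovPart r p (⌊r⌋₊ + 1) e f

/-- Membership in `S^r_{p,p}B(ℝ^d)`: `f ∈ L_p(ℝ^d)` and the Besov norm is finite. -/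
def MemBesov {d : ℕ} (r : ℝ) (p : ℝ≥0∞) (f : (Fin d → ℝ) → ℂ) : Prop :=
  MemLp f p volume ∧ besovNorm r p f < ∞

end

/-! The mixed norm is multiplicative across directions: oscillation at frequency `ω` in one variable
costs about `ω^r`, in two variables `ω^(2r)`. Let `f` and `g` be tensor bumps, `f` modulated by `ω =
π 2^(n+1)` in direction `i` only, `g` in direction `j ≠ i` only. Both have sup norm at most 1, so
the right-hand side sees just one oscillating direction, while `f * g` oscillates in two. It
suffices to bound the single norms by `K ω^s` for some `r < s < 2r`
(`exists_besovNorm_modulatedTensor_le`); the loss `s - r` turns the Besov sums into convergent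
geometric series. The product has norm at least `c 2^(2rn)` (`le_besovNorm_modulatedTensor`). The
inequality would thus keep `2^((2r-s)n)` bounded in `n`. -/

/-! ### Mixed differences of tensor products -/

theorem directionalDiff_prod {d : ℕ} (m : ℕ) (h : ℝ) (j : Fin d) (v : Fin d → ℝ → ℂ) :
    directionalDiff m h j (fun x => ∏ i, v i (x i)) =
      fun x => ∏ i, Function.update v j ((fwdDiff h)^[m] (v j)) i (x i) := by
  funext x
  change ∑ l ∈ Finset.range (m + 1), (-1 : ℂ) ^ (m - l) * (m.choose l : ℂ) *
    ∏ i, v i (Function.update x j (x j + l * h) i) = _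
  rw [← Finset.mul_prod_erase Finset.univ _ (Finset.mem_univ j)]
  rw [Function.update_self, fwdDiff_iter_eq_sum_shift, Finset.sum_mul]
  refine Finset.sum_congr rfl fun l _ => ?_
  rw [← Finset.mul_prod_erase Finset.univ _ (Finset.mem_univ j), Function.update_self]
  have : ∏ i ∈ Finset.univ.erase j, v i (Function.update x j (x j + l * h) i) =
      ∏ i ∈ Finset.univ.erase j, Function.update v j ((fwdDiff h)^[m] (v j)) i (x i) := by
    refine Finset.prod_congr rfl fun i hi => ?_
    rw [Function.update_of_ne (Finset.ne_of_mem_erase hi),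
      Function.update_of_ne (Finset.ne_of_mem_erase hi)]
  rw [this]
  simp only [nsmul_eq_mul, zsmul_eq_mul]
  push_cast
  ring

theorem mixedDiff_prod {d : ℕ} (m : ℕ) (e : Finset (Fin d)) (h : Fin d → ℝ)
    (v : Fin d → ℝ → ℂ) :
    mixedDiff m e h (fun x => ∏ i, v i (x i)) =
      fun x => ∏ i, (if i ∈ e then (fwdDiff (h i))^[m] (v i) else v i) (x i) := by
  induction e using Finset.induction_on with
  | empty => simp [mixedDiff]
  | insert a s ha ih =>
    rw [mixedDiff, Finset.noncommProd_insert_of_notMem _ _ _ _ ha, Module.End.mul_apply]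
    change directionalDiff m (h a) a (mixedDiff m s h _) = _
    rw [ih, directionalDiff_prod m (h a) a]
    funext x
    refine Finset.prod_congr rfl fun i _ => ?_
    by_cases hi : i = a
    · subst hi
      simp [ha]
    · rw [Function.update_of_ne hi]
      simp [hi]

/-! ### Iterated differences in one variable -/

/-- Induction on the order: by the mean value inequality, one difference trades one derivative for a
factor `|h|`. -/
theorem norm_fwdDiff_iter_le (h : ℝ) (m : ℕ) :
    ∀ (u : ℝ → ℂ) (M : ℝ), ContDiff ℝ m u → (∀ x, ‖iteratedDeriv m u x‖ ≤ M) →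
      ∀ x, ‖(fwdDiff h)^[m] u x‖ ≤ M * |h| ^ m := by
  induction m with
  | zero => intro u M _ hM x; simpa using hM x
  | succ m ih =>
    intro u M hu hM x
    have hu' : ContDiff ℝ m u := hu.of_le (by exact_mod_cast Nat.le_succ m)
    have hs : ContDiff ℝ m (fun x => u (x + h)) := hu'.comp (contDiff_id.add contDiff_const)
    have key := ih (fwdDiff h u) (M * |h|) (hs.sub hu') (fun y => ?_) x
    · rw [Function.iterate_succ_apply]
      calc _ ≤ _ := key
        _ = _ := by ring
    · have : iteratedDeriv m (fwdDiff h u) y =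
          iteratedDeriv m u (y + h) - iteratedDeriv m u y := by
        change iteratedDeriv m (fun x => u (x + h) - u x) y = _
        rw [iteratedDeriv_fun_sub hs.contDiffAt hu'.contDiffAt, iteratedDeriv_comp_add_const]
      rw [this]
      have hd : Differentiable ℝ (iteratedDeriv m u) :=
        hu.differentiable_iteratedDeriv m (by exact_mod_cast Nat.lt_succ_self m)
      have := Convex.norm_image_sub_le_of_norm_deriv_le (𝕜 := ℝ) (s := Set.univ)
        (f := iteratedDeriv m u) (C := M) (x := y) (y := y + h) (fun z _ => hd z)
        (fun z _ => by rw [← iteratedDeriv_succ]; exact hM z) convex_univ trivial trivial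
      simpa using this

theorem norm_fwdDiff_iter_le_two_pow (h : ℝ) {M : ℝ} (m : ℕ) (u : ℝ → ℂ) (hM : ∀ x, ‖u x‖ ≤ M) :
    ∀ x, ‖(fwdDiff h)^[m] u x‖ ≤ 2 ^ m * M := by
  induction m with
  | zero => intro x; simpa using hM x
  | succ m ih =>
    intro x
    rw [Function.iterate_succ_apply']
    calc ‖(fwdDiff h)^[m] u (x + h) - (fwdDiff h)^[m] u x‖
        ≤ ‖(fwdDiff h)^[m] u (x + h)‖ + ‖(fwdDiff h)^[m] u x‖ := norm_sub_le _ _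
      _ ≤ 2 ^ m * M + 2 ^ m * M := add_le_add (ih _) (ih _)
      _ = _ := by ring

theorem fwdDiff_iter_eq_zero {h R : ℝ} (hh : |h| ≤ 1) (u : ℝ → ℂ) (hu : ∀ x, R < |x| → u x = 0)
    (m : ℕ) : ∀ x, R + m < |x| → (fwdDiff h)^[m] u x = 0 := by
  induction m with
  | zero => intro x hx; exact hu x (by simpa using hx)
  | succ m ih =>
    intro x hx
    push_cast at hx
    have := abs_sub_abs_le_abs_sub x (-h)
    rw [sub_neg_eq_add, abs_neg] at this
    rw [Function.iterate_succ_apply', fwdDiff, ih _ (by linarith), ih _ (by linarith), sub_zero]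

/-! ### Modulated functions in one variable -/

/-- The function `φ` modulated with frequency `ω`. -/
noncomputable def modulate (ω : ℝ) (φ : ℝ → ℂ) (x : ℝ) : ℂ := Complex.exp (ω * x * Complex.I) * φ x

theorem norm_modulate (ω : ℝ) (φ : ℝ → ℂ) (x : ℝ) : ‖modulate ω φ x‖ = ‖φ x‖ := by
  rw [modulate, norm_mul, ← Complex.ofReal_mul, Complex.norm_exp_ofReal_mul_I, one_mul]

theorem contDiff_modulate (ω : ℝ) {φ : ℝ → ℂ} {n : WithTop ℕ∞} (hφ : ContDiff ℝ n φ) :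
    ContDiff ℝ n (modulate ω φ) := by
  unfold modulate
  have : ContDiff ℝ n (fun x : ℝ => (x : ℂ)) := Complex.ofRealCLM.contDiff
  fun_prop

theorem deriv_modulate (ω : ℝ) {φ : ℝ → ℂ} (hφ : Differentiable ℝ φ) :
    deriv (modulate ω φ) =
      (ω * Complex.I : ℂ) • modulate ω φ + modulate ω (deriv φ) := by
  funext x
  have h1 : HasDerivAt (fun x : ℝ => (ω * x * Complex.I : ℂ)) (ω * Complex.I) x := by
    have := ((Complex.ofRealCLM.hasDerivAt (x := x)).const_mul (ω : ℂ)).mul_const Complex.I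
    simpa using this
  have := (h1.cexp.mul (hφ x).hasDerivAt).deriv
  change deriv (fun y : ℝ => Complex.exp (ω * y * Complex.I) * φ y) x = _
  refine this.trans ?_
  simp only [modulate, Pi.add_apply, Pi.smul_apply, smul_eq_mul]
  ring

/-- Each derivative hits the exponential, costing `|ω| ≤ N`, or `φ`, costing a constant; hence the
induction over all `φ`. A separate `N ≥ 1` also covers `ω = 0`. -/
theorem exists_norm_iteratedDeriv_modulate_le (m : ℕ) :
    ∀ φ : ℝ → ℂ, ContDiff ℝ (⊤ : ℕ∞) φ → HasCompactSupport φ →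
      ∃ C : ℝ, ∀ ω N : ℝ, |ω| ≤ N → 1 ≤ N →
        ∀ x, ‖iteratedDeriv m (modulate ω φ) x‖ ≤ C * N ^ m := by
  induction m with
  | zero =>
    intro φ hφ hc
    obtain ⟨C, hC⟩ := hc.exists_bound_of_continuous hφ.continuous
    exact ⟨C, fun ω N _ _ x => by simpa [norm_modulate] using hC x⟩
  | succ m ih =>
    intro φ hφ hc
    have hφ' : ContDiff ℝ (⊤ : ℕ∞) (deriv φ) := (contDiff_infty_iff_deriv.1 hφ).2
    obtain ⟨C₁, h₁⟩ := ih φ hφ hc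
    obtain ⟨C₂, h₂⟩ := ih (deriv φ) hφ' hc.deriv
    refine ⟨C₁ + C₂, fun ω N hω hN x => ?_⟩
    have hle : ((m : ℕ∞) : WithTop ℕ∞) ≤ ((⊤ : ℕ∞) : WithTop ℕ∞) := by exact_mod_cast le_top
    have c₁ : ContDiff ℝ m (modulate ω φ) := contDiff_modulate ω (hφ.of_le hle)
    have c₂ : ContDiff ℝ m (modulate ω (deriv φ)) := contDiff_modulate ω (hφ'.of_le hle)
    have cs : ContDiff ℝ m ((ω * Complex.I : ℂ) • modulate ω φ) :=
      c₁.const_smul (ω * Complex.I : ℂ)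
    rw [iteratedDeriv_succ', deriv_modulate ω (contDiff_infty_iff_deriv.1 hφ).1,
      iteratedDeriv_add cs.contDiffAt c₂.contDiffAt,
      iteratedDeriv_const_smul c₁.contDiffAt]
    refine (norm_add_le _ _).trans ?_
    rw [norm_smul]
    have e₁ := h₁ ω N hω hN x
    have e₂ := h₂ ω N hω hN x
    have n1 : ‖(ω * Complex.I : ℂ)‖ = |ω| := by simp
    rw [n1]
    have p1 : |ω| * ‖iteratedDeriv m (modulate ω φ) x‖ ≤ N * (C₁ * N ^ m) :=
      mul_le_mul hω e₁ (norm_nonneg _) (by linarith)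
    have p2 : C₂ * N ^ m ≤ N * (C₂ * N ^ m) :=
      le_mul_of_one_le_left ((norm_nonneg _).trans e₂) hN
    calc _ ≤ N * (C₁ * N ^ m) + N * (C₂ * N ^ m) := add_le_add p1 (e₂.trans p2)
      _ = _ := by ring

/-- Interpolates between the derivative bound `(N|h|)^m`, used for `N|h| ≤ 1`, and the trivial bound
`2^m M`, used for `N|h| ≥ 1`. -/
theorem exists_norm_fwdDiff_iter_modulate_le {φ : ℝ → ℂ} (hφ : ContDiff ℝ (⊤ : ℕ∞) φ)
    (hc : HasCompactSupport φ) (m : ℕ) {s : ℝ} (hs : 0 ≤ s) (hsm : s ≤ m) :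
    ∃ C : ℝ, 0 ≤ C ∧ ∀ ω N : ℝ, |ω| ≤ N → 1 ≤ N → ∀ h x : ℝ,
      ‖(fwdDiff h)^[m] (modulate ω φ) x‖ ≤ C * (N ^ s * |h| ^ s) := by
  obtain ⟨C, hC⟩ := exists_norm_iteratedDeriv_modulate_le m φ hφ hc
  obtain ⟨M, hM⟩ := hc.exists_bound_of_continuous hφ.continuous
  have hM0 : 0 ≤ M := (norm_nonneg _).trans (hM 0)
  refine ⟨max C (2 ^ m * M), le_max_of_le_right (by positivity), fun ω N hω hN h x => ?_⟩
  have hN0 : 0 ≤ N := by linarith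
  have hle : ((m : ℕ∞) : WithTop ℕ∞) ≤ ((⊤ : ℕ∞) : WithTop ℕ∞) := by exact_mod_cast le_top
  rw [← Real.mul_rpow hN0 (abs_nonneg h)]
  rcases le_total (N * |h|) 1 with h1 | h1
  · have e1 := norm_fwdDiff_iter_le h m (modulate ω φ) (C * N ^ m)
      (contDiff_modulate ω (hφ.of_le hle)) (hC ω N hω hN) x
    calc _ ≤ _ := e1
      _ = C * (N * |h|) ^ m := by ring
      _ ≤ max C (2 ^ m * M) * (N * |h|) ^ m := by gcongr; exact le_max_left _ _
      _ ≤ _ := by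
        rcases (by positivity : 0 ≤ N * |h|).eq_or_lt with h0 | h0
        · rw [← h0]
          rcases Nat.eq_zero_or_pos m with rfl | hm
          · have : s = 0 := le_antisymm (by simpa using hsm) hs
            simp [this]
          · rw [zero_pow hm.ne']
            have : (0:ℝ) ≤ 0 ^ s := Real.rpow_nonneg le_rfl _
            gcongr
        · gcongr
          rw [← Real.rpow_natCast]
          exact Real.rpow_le_rpow_of_exponent_ge h0 h1 hsm
  · calc _ ≤ 2 ^ m * M := norm_fwdDiff_iter_le_two_pow h m _
          (fun y => (norm_modulate ω φ y).trans_le (hM y)) x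
      _ ≤ max C (2 ^ m * M) := le_max_right _ _
      _ ≤ _ := le_mul_of_one_le_right (le_max_of_le_right (by positivity))
          (Real.one_le_rpow h1 hs)

/-- A shift by half a period flips the sign of the exponential, so each difference becomes, up to
sign, a sum `φ(y + h) + φ(y)`, in which nonnegative terms cannot cancel. -/
theorem norm_le_norm_fwdDiff_iter_modulate {h ω : ℝ} (hω : ω * h = Real.pi) (φ : ℝ → ℝ)
    (hφ : ∀ x, 0 ≤ φ x) (m : ℕ) (x : ℝ) :
    φ x ≤ ‖(fwdDiff h)^[m] (modulate ω (fun y => (φ y : ℂ))) x‖ := by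
  obtain ⟨ψ, hψ, hle⟩ : ∃ ψ : ℝ → ℝ, (fwdDiff h)^[m] (modulate ω (fun y => (φ y : ℂ))) =
      (-1 : ℂ) ^ m • modulate ω (fun y => (ψ y : ℂ)) ∧ ∀ y, φ y ≤ ψ y := by
    induction m with
    | zero => exact ⟨φ, by simp, fun _ => le_rfl⟩
    | succ m ih =>
      obtain ⟨ψ, hψ, hle⟩ := ih
      refine ⟨fun y => ψ (y + h) + ψ y, ?_, fun y => ?_⟩
      · rw [Function.iterate_succ_apply', hψ]
        funext y
        have : Complex.exp (ω * ↑(y + h) * Complex.I) = -Complex.exp (ω * y * Complex.I) := by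
          have e : (ω * ↑(y + h) * Complex.I : ℂ) = ω * y * Complex.I + Real.pi * Complex.I := by
            rw [← hω]; push_cast; ring
          rw [e, Complex.exp_add, Complex.exp_pi_mul_I]; ring
        simp only [fwdDiff, Pi.smul_apply, modulate, smul_eq_mul, this]
        push_cast
        ring
      · have := hle y
        have := (hφ (y + h)).trans (hle (y + h))
        linarith
  rw [hψ, Pi.smul_apply, norm_smul, norm_modulate]
  simp only [norm_pow, norm_neg, norm_one, one_pow, one_mul, Complex.norm_real]
  exact (hle x).trans (le_abs_self _)

/-! ### Upper bounds for the Besov norm -/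

theorem tsum_two_rpow_mul_sum_ne_top {b : ℝ} (hb : b < 0) (d : ℕ) :
    ∑' k : Fin d → ℕ, (2 : ℝ≥0∞) ^ (b * ∑ i, (k i : ℝ)) ≠ ∞ := by
  induction d with
  | zero => simp
  | succ d ih =>
    rw [← (Fin.consEquiv fun _ => ℕ).tsum_eq, ENNReal.tsum_prod']
    have hterm : ∀ (a : ℕ) (k : Fin d → ℕ),
        (2 : ℝ≥0∞) ^ (b * ∑ i, ((Fin.consEquiv (fun _ => ℕ) (a, k) i : ℕ) : ℝ)) =
          ((2 : ℝ≥0∞) ^ b) ^ a * (2 : ℝ≥0∞) ^ (b * ∑ i, (k i : ℝ)) := by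
      intro a k
      rw [← ENNReal.rpow_natCast, ← ENNReal.rpow_mul,
        ← ENNReal.rpow_add _ _ two_ne_zero ENNReal.ofNat_ne_top]
      congr 1
      simp [Fin.consEquiv, Fin.sum_univ_succ, mul_add]
    simp only [hterm, ENNReal.tsum_mul_left, ENNReal.tsum_mul_right]
    refine ENNReal.mul_ne_top ?_ ih
    rw [ENNReal.tsum_geometric]
    have : (2 : ℝ≥0∞) ^ b < 1 := ENNReal.rpow_lt_one_of_one_lt_of_neg ENNReal.one_lt_two hb
    simpa [tsub_eq_zero_iff_le] using this

theorem exists_besovNorm_le (d : ℕ) {r s : ℝ} (hrs : r < s) {p : ℝ≥0∞} (hp : 1 ≤ p) :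
    ∃ K : ℝ≥0∞, K ≠ ∞ ∧ ∀ (f : (Fin d → ℝ) → ℂ) (A : ℝ≥0∞),
      (∀ e, ∀ k ∈ multiIndices e, mixedModulus (⌊r⌋₊ + 1) e p f (fun i => ((2 : ℝ) ^ k i)⁻¹) ≤
        A * (2 : ℝ≥0∞) ^ (-s * ∑ i, (k i : ℝ))) → besovNorm r p f ≤ K * A := by
  suffices h : ∃ K : ℝ≥0∞, K ≠ ∞ ∧ ∀ (f : (Fin d → ℝ) → ℂ) (A : ℝ≥0∞) (e : Finset (Fin d)),
      (∀ k ∈ multiIndices e, mixedModulus (⌊r⌋₊ + 1) e p f (fun i => ((2 : ℝ) ^ k i)⁻¹) ≤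
        A * (2 : ℝ≥0∞) ^ (-s * ∑ i, (k i : ℝ))) → besovPart r p (⌊r⌋₊ + 1) e f ≤ K * A by
    obtain ⟨K, hK, h⟩ := h
    refine ⟨(Finset.univ : Finset (Finset (Fin d))).card * K,
      ENNReal.mul_ne_top (ENNReal.natCast_ne_top _) hK, fun f A hA => ?_⟩
    refine (Finset.sum_le_card_nsmul _ _ _ fun e _ => h f A e (hA e)).trans ?_
    rw [nsmul_eq_mul, mul_assoc]
  have hmul : ∀ (σ : ℝ) (A : ℝ≥0∞), (2 : ℝ≥0∞) ^ (r * σ) * (A * (2 : ℝ≥0∞) ^ (-s * σ)) =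
      A * (2 : ℝ≥0∞) ^ ((r - s) * σ) := by
    intro σ A
    rw [mul_left_comm, ← ENNReal.rpow_add _ _ two_ne_zero ENNReal.ofNat_ne_top]
    congr 2
    ring
  by_cases hpt : p = ∞
  · refine ⟨1, ENNReal.one_ne_top, fun f A e hA => ?_⟩
    rw [besovPart, if_pos hpt, one_mul]
    refine iSup_le fun k => ?_
    refine (mul_le_mul_right (hA k.1 k.2) _).trans ?_
    rw [hmul]
    refine mul_le_of_le_one_right' ?_
    have hσ : (r - s) * ∑ i, (k.1 i : ℝ) ≤ 0 :=
      mul_nonpos_of_nonpos_of_nonneg (by linarith) (Finset.sum_nonneg fun _ _ => Nat.cast_nonneg _)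
    simpa using ENNReal.rpow_le_rpow_of_exponent_le ENNReal.one_lt_two.le hσ
  · have hq : 0 < p.toReal := ENNReal.toReal_pos (by positivity) hpt
    refine ⟨(∑' k : Fin d → ℕ, (2 : ℝ≥0∞) ^ ((r - s) * p.toReal * ∑ i, (k i : ℝ))) ^
      (1 / p.toReal), ?_, fun f A e hA => ?_⟩
    · exact ENNReal.rpow_ne_top_of_nonneg (by positivity)
        (tsum_two_rpow_mul_sum_ne_top (mul_neg_of_neg_of_pos (by linarith) hq) d)
    · rw [besovPart, if_neg hpt]
      have hAq : A = (A ^ p.toReal) ^ (1 / p.toReal) := by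
        rw [← ENNReal.rpow_mul, mul_one_div_cancel hq.ne', ENNReal.rpow_one]
      rw [hAq, ← ENNReal.mul_rpow_of_nonneg _ _ (by positivity : 0 ≤ 1 / p.toReal)]
      refine ENNReal.rpow_le_rpow ?_ (by positivity)
      rw [← ENNReal.tsum_mul_right]
      -- Enlarging the sum to all of `ℕ^d` makes the constant independent of `e`.
      refine le_trans (ENNReal.tsum_le_tsum fun k => ?_)
        (ENNReal.tsum_comp_le_tsum_of_injective (f := ((↑) : multiIndices e → Fin d → ℕ))
          Subtype.val_injective
          (fun k => (2 : ℝ≥0∞) ^ ((r - s) * p.toReal * ∑ i, (k i : ℝ)) * A ^ p.toReal))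
      rw [ENNReal.rpow_mul, ← ENNReal.mul_rpow_of_nonneg _ _ hq.le]
      refine (ENNReal.rpow_le_rpow (mul_le_mul_right (hA k.1 k.2) _) hq.le).trans_eq ?_
      rw [hmul, ENNReal.mul_rpow_of_nonneg _ _ hq.le, ← ENNReal.rpow_mul, mul_comm]
      congr 2
      ring

/-- The estimate factorises. Directions outside `e` contribute no decay, but there `k i = 0`, so
none is needed. -/
theorem mixedModulus_prod_le {d m : ℕ} {s : ℝ} (hs : 0 ≤ s) (p : ℝ≥0∞) (v : Fin d → ℝ → ℂ)
    (S : Set ℝ) (B : Fin d → ℝ) (hB : ∀ i, 0 ≤ B i) (hv : ∀ i x, ‖v i x‖ ≤ B i * S.indicator 1 x)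
    (hΔ : ∀ i h x, |h| ≤ 1 → ‖(fwdDiff h)^[m] (v i) x‖ ≤ B i * |h| ^ s * S.indicator 1 x)
    (e : Finset (Fin d)) (k : Fin d → ℕ) (hk : k ∈ multiIndices e) :
    mixedModulus m e p (fun x => ∏ i, v i (x i)) (fun i => ((2 : ℝ) ^ k i)⁻¹) ≤
      (ENNReal.ofReal (∏ i, B i) *
        eLpNorm (fun x : Fin d → ℝ => ∏ i, S.indicator (1 : ℝ → ℝ) (x i)) p volume) *
        (2 : ℝ≥0∞) ^ (-s * ∑ i, (k i : ℝ)) := by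
  refine iSup₂_le fun h hh => ?_
  have h2 : (2 : ℝ≥0∞) ^ (-s * ∑ i, (k i : ℝ)) =
      ENNReal.ofReal (∏ i, ((2 : ℝ) ^ k i)⁻¹ ^ s) := by
    have : ∏ i, ((2 : ℝ) ^ k i)⁻¹ ^ s = (2 : ℝ) ^ (-s * ∑ i, (k i : ℝ)) := by
      rw [Finset.mul_sum, Real.rpow_sum_of_pos two_pos]
      refine Finset.prod_congr rfl fun i _ => ?_
      rw [← Real.rpow_natCast, ← Real.rpow_neg two_pos.le, ← Real.rpow_mul two_pos.le]
      congr 1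
      ring
    rw [this, ← ENNReal.ofReal_rpow_of_pos two_pos]
    norm_num
  have hB' : 0 ≤ ∏ i, B i := Finset.prod_nonneg fun i _ => hB i
  rw [h2, mul_right_comm, ← ENNReal.ofReal_mul hB', mixedDiff_prod]
  refine eLpNorm_le_mul_eLpNorm_of_ae_le_mul (ae_of_all _ fun x => ?_) p
  rw [norm_prod, norm_prod, ← Finset.prod_mul_distrib, ← Finset.prod_mul_distrib]
  refine Finset.prod_le_prod (fun _ _ => norm_nonneg _) fun i _ => ?_
  have hχ : 0 ≤ S.indicator (1 : ℝ → ℝ) (x i) := Set.indicator_nonneg (fun _ _ => zero_le_one) _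
  rw [Real.norm_of_nonneg hχ]
  by_cases hi : i ∈ e
  · rw [if_pos hi]
    have h3 := (hh i hi).le
    have h4 : ((2 : ℝ) ^ k i)⁻¹ ≤ 1 := inv_le_one_of_one_le₀ (one_le_pow₀ one_le_two)
    refine (hΔ i (h i) (x i) (h3.trans h4)).trans ?_
    have := hB i
    gcongr
  · rw [if_neg hi, hk i hi]
    simpa using hv i (x i)

/-- The tensor product of modulations of `φ` with frequencies `w i`. -/
noncomputable def modulatedTensor {d : ℕ} (w : Fin d → ℝ) (φ : ℝ → ℂ) (x : Fin d → ℝ) : ℂ :=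
  ∏ i, modulate (w i) φ (x i)

theorem norm_modulatedTensor {d : ℕ} (w : Fin d → ℝ) (φ : ℝ → ℂ) (x : Fin d → ℝ) :
    ‖modulatedTensor w φ x‖ = ∏ i, ‖φ (x i)‖ := by
  simp [modulatedTensor, norm_prod, norm_modulate]

theorem eLpNorm_prod_indicator_ne_top (d : ℕ) (R : ℝ) (p : ℝ≥0∞) :
    eLpNorm (fun x : Fin d → ℝ => ∏ i, (Set.Icc (-R) R).indicator (1 : ℝ → ℝ) (x i)) p volume
      ≠ ∞ := by
  have : (fun x : Fin d → ℝ => ∏ i, (Set.Icc (-R) R).indicator (1 : ℝ → ℝ) (x i)) =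
      (Set.pi Set.univ fun _ : Fin d => Set.Icc (-R) R).indicator fun _ => (1 : ℝ) := by
    funext x
    by_cases hx : x ∈ Set.pi Set.univ fun _ : Fin d => Set.Icc (-R) R
    · rw [Set.indicator_of_mem hx]
      exact Finset.prod_eq_one fun i _ => Set.indicator_of_mem (hx i trivial) _
    · rw [Set.indicator_of_notMem hx]
      simp only [Set.mem_pi, Set.mem_univ, forall_const, not_forall] at hx
      obtain ⟨i, hi⟩ := hx
      exact Finset.prod_eq_zero (Finset.mem_univ i) (Set.indicator_of_notMem hi _)
  rw [this]
  refine (memLp_indicator_const p (MeasurableSet.univ_pi fun _ => measurableSet_Icc) _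
    (Or.inr ?_)).eLpNorm_ne_top
  exact (isCompact_univ_pi fun _ => isCompact_Icc).measure_lt_top.ne

theorem exists_besovNorm_modulatedTensor_le (d : ℕ) {r s : ℝ} (hr : 0 < r) (hrs : r < s)
    (hs : s ≤ ⌊r⌋₊ + 1) {p : ℝ≥0∞} (hp : 1 ≤ p) {φ : ℝ → ℂ} (hφ : ContDiff ℝ (⊤ : ℕ∞) φ)
    {R : ℝ} (hR : ∀ x, R < |x| → φ x = 0) :
    ∃ K : ℝ≥0∞, K ≠ ∞ ∧ ∀ (j : Fin d) (ω : ℝ), 1 ≤ ω →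
      besovNorm r p (modulatedTensor (Pi.single j ω) φ) ≤ K * ENNReal.ofReal (ω ^ s) := by
  have hc : HasCompactSupport φ := by
    refine HasCompactSupport.of_support_subset_isCompact (isCompact_Icc (a := -R) (b := R)) ?_
    intro x hx
    rw [Set.mem_Icc, ← abs_le]
    exact not_lt.1 fun h => hx (hR x h)
  obtain ⟨K, hK, hKle⟩ := exists_besovNorm_le d hrs hp
  obtain ⟨C, hC0, hC⟩ := exists_norm_fwdDiff_iter_modulate_le hφ hc (⌊r⌋₊ + 1)
    (hr.le.trans hrs.le) (by exact_mod_cast hs)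
  obtain ⟨M, hM⟩ := hc.exists_bound_of_continuous hφ.continuous
  set m := ⌊r⌋₊ + 1
  set D := max C M
  have hD0 : 0 ≤ D := hC0.trans (le_max_left _ _)
  -- Each of the `m` differences with `|h| ≤ 1` widens the support by at most 1, hence `R + m`.
  set E := eLpNorm
    (fun x : Fin d → ℝ => ∏ i, (Set.Icc (-(R + m)) (R + m)).indicator (1 : ℝ → ℝ) (x i)) p volume
  refine ⟨K * (ENNReal.ofReal (D ^ d) * E), ENNReal.mul_ne_top hK (ENNReal.mul_ne_top
    ENNReal.ofReal_ne_top (eLpNorm_prod_indicator_ne_top d _ p)), fun j ω hω => ?_⟩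
  have hωs : 1 ≤ ω ^ s := Real.one_le_rpow hω (hr.le.trans hrs.le)
  set N : Fin d → ℝ := fun i => if i = j then ω else 1
  have hN1 : ∀ i, 1 ≤ N i := fun i => by dsimp only [N]; split_ifs <;> simp [hω]
  have hwN : ∀ i, |(Pi.single j ω : Fin d → ℝ) i| ≤ N i := fun i => by
    by_cases h : i = j
    · subst h; simp [N, abs_of_nonneg (zero_le_one.trans hω)]
    · simp [N, h]
  have hNs : ∀ i, 1 ≤ N i ^ s := fun i => Real.one_le_rpow (hN1 i) (hr.le.trans hrs.le)
  have hprod : ∏ i, D * N i ^ s = D ^ d * ω ^ s := by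
    rw [Finset.prod_mul_distrib]
    congr 1
    · simp
    · rw [Finset.prod_eq_single j (fun i _ hi => by simp [N, hi]) (by simp)]
      simp [N]
  have hind : ∀ {u : ℝ → ℂ} {b x : ℝ}, (R + m < |x| → u x = 0) → ‖u x‖ ≤ b →
      ‖u x‖ ≤ b * (Set.Icc (-(R + m)) (R + m)).indicator 1 x := by
    intro u b x h0 hb
    by_cases hx : x ∈ Set.Icc (-(R + m)) (R + m)
    · rwa [Set.indicator_of_mem hx, Pi.one_apply, mul_one]
    · rw [Set.mem_Icc, ← abs_le, not_le] at hx
      simp only [h0 hx, norm_zero]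
      exact mul_nonneg ((norm_nonneg _).trans hb) (Set.indicator_nonneg (fun _ _ => zero_le_one) _)
  have hsupp : ∀ i x, R < |x| → modulate ((Pi.single j ω : Fin d → ℝ) i) φ x = 0 := by
    intro i x hx
    simp [modulate, hR x hx]
  refine (hKle _ (ENNReal.ofReal (D ^ d * ω ^ s) * E) fun e k hk => ?_).trans_eq ?_
  · rw [← hprod]
    refine mixedModulus_prod_le (hr.le.trans hrs.le) p _ _ _
      (fun i => by have := hNs i; positivity) (fun i x => ?_) (fun i h x hh => ?_) e k hk
    · refine hind (fun hx => hsupp i x ?_) ?_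
      · exact lt_of_le_of_lt (by simp) hx
      · rw [norm_modulate]
        exact ((hM x).trans (le_max_right _ _)).trans (le_mul_of_one_le_right hD0 (hNs i))
    · refine hind (fwdDiff_iter_eq_zero hh _ (hsupp i) m x) ?_
      refine (hC _ (N i) (hwN i) (hN1 i) h x).trans ?_
      rw [← mul_assoc]
      have := hNs i
      gcongr
      exact le_max_left _ _
  · rw [ENNReal.ofReal_mul (by positivity)]
    ring

/-! ### Lower bound for two oscillating directions -/

/-- A single term of the norm suffices: `e = {i, j}`, with `k` equal to `n` on `e`. -/
theorem le_besovNorm_modulatedTensor {d : ℕ} {r : ℝ} {p : ℝ≥0∞} (hp : 1 ≤ p) {φ : ℝ → ℝ}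
    (hφ : ∀ x, 0 ≤ φ x) {i j : Fin d} (hij : i ≠ j) (n : ℕ) (w : Fin d → ℝ)
    (hwi : w i = Real.pi * 2 ^ (n + 1)) (hwj : w j = Real.pi * 2 ^ (n + 1)) :
    (2 : ℝ≥0∞) ^ (r * (2 * n)) * eLpNorm (fun x : Fin d → ℝ => ∏ l, φ (x l)) p volume ≤
      besovNorm r p (modulatedTensor w fun y => (φ y : ℂ)) := by
  set m := ⌊r⌋₊ + 1
  set e : Finset (Fin d) := {i, j}
  set k : Fin d → ℕ := fun l => if l ∈ e then n else 0
  have hk : k ∈ multiIndices e := fun l hl => if_neg hl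
  have hsum : ∑ l, (k l : ℝ) = 2 * n := by
    simp only [k, Nat.cast_ite, Nat.cast_zero, Finset.sum_ite_mem, Finset.univ_inter]
    rw [Finset.sum_pair hij, two_mul]
  set f := modulatedTensor w fun y => (φ y : ℂ)
  set E := eLpNorm (fun x : Fin d → ℝ => ∏ l, φ (x l)) p volume
  have hE : E ≤ mixedModulus m e p f (fun l => ((2 : ℝ) ^ k l)⁻¹) := by
    -- The step `2^(-(n+1))` is half a period of the modulation and satisfies the strict constraint
    -- `|h| < 2^(-n)`.
    refine le_trans ?_ (le_iSup₂_of_le (fun _ => ((2 : ℝ) ^ (n + 1))⁻¹) (fun l hl => ?_) le_rfl)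
    · change _ ≤ eLpNorm (mixedDiff m e _ (fun x => ∏ l, modulate (w l) _ (x l))) p volume
      rw [mixedDiff_prod]
      refine eLpNorm_mono fun x => ?_
      rw [norm_prod, norm_prod]
      refine Finset.prod_le_prod (fun _ _ => norm_nonneg _) fun l _ => ?_
      rw [Real.norm_of_nonneg (hφ _)]
      split_ifs with hl
      · refine norm_le_norm_fwdDiff_iter_modulate ?_ φ hφ m _
        have : w l = Real.pi * 2 ^ (n + 1) := by
          rcases Finset.mem_insert.1 hl with rfl | hl
          · exact hwi
          · rw [Finset.mem_singleton.1 hl, hwj]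
        rw [this]
        field_simp
      · rw [norm_modulate, Complex.norm_real]
        exact le_abs_self _
    · simp only [k, if_pos hl]
      rw [abs_of_pos (by positivity)]
      exact inv_strictAnti₀ (by positivity) (pow_lt_pow_right₀ one_lt_two n.lt_succ_self)
  refine le_trans ?_ (Finset.single_le_sum (f := fun e => besovPart r p m e f)
    (fun _ _ => zero_le) (Finset.mem_univ e))
  rw [besovPart]
  split_ifs with hpt
  · refine le_trans ?_ (le_iSup _ (⟨k, hk⟩ : multiIndices e))
    rw [hsum]
    gcongr
  · have hq : 0 < p.toReal := ENNReal.toReal_pos (by positivity) hpt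
    refine le_trans ?_ (ENNReal.rpow_le_rpow (ENNReal.le_tsum (⟨k, hk⟩ : multiIndices e))
      (by positivity))
    rw [hsum, ENNReal.rpow_mul 2 (r * (2 * n)), ← ENNReal.mul_rpow_of_nonneg _ _ hq.le, ← ENNReal.rpow_mul,
      mul_one_div_cancel hq.ne', ENNReal.rpow_one]
    gcongr

/-! ### Products and size of modulated tensors -/

theorem continuous_modulatedTensor {d : ℕ} (w : Fin d → ℝ) {φ : ℝ → ℂ} (hφ : Continuous φ) :
    Continuous (modulatedTensor w φ) :=
  continuous_finsetProd _ fun i _ =>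
    (contDiff_modulate (w i) (contDiff_zero.2 hφ)).continuous.comp (continuous_apply i)

theorem modulatedTensor_mul {d : ℕ} (w w' : Fin d → ℝ) (φ ψ : ℝ → ℂ) (x : Fin d → ℝ) :
    modulatedTensor w φ x * modulatedTensor w' ψ x =
      modulatedTensor (w + w') (fun y => φ y * ψ y) x := by
  rw [modulatedTensor, modulatedTensor, modulatedTensor, ← Finset.prod_mul_distrib]
  refine Finset.prod_congr rfl fun i _ => ?_
  simp only [modulate, Pi.add_apply, Complex.ofReal_add, add_mul, Complex.exp_add]
  ring

theorem norm_modulatedTensor_le_prod_indicator {d : ℕ} (w : Fin d → ℝ) {φ : ℝ → ℂ} {R : ℝ}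
    (hφ : ∀ x, ‖φ x‖ ≤ 1) (hR : ∀ x, R < |x| → φ x = 0) (x : Fin d → ℝ) :
    ‖modulatedTensor w φ x‖ ≤ ∏ i, (Set.Icc (-R) R).indicator (1 : ℝ → ℝ) (x i) := by
  rw [norm_modulatedTensor]
  refine Finset.prod_le_prod (fun _ _ => norm_nonneg _) fun i _ => ?_
  by_cases hx : x i ∈ Set.Icc (-R) R
  · rw [Set.indicator_of_mem hx]
    exact hφ _
  · rw [Set.indicator_of_notMem hx]
    rw [Set.mem_Icc, ← abs_le, not_le] at hx
    simp [hR _ hx]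

theorem memLp_modulatedTensor {d : ℕ} (w : Fin d → ℝ) {φ : ℝ → ℂ} {R : ℝ} (hc : Continuous φ)
    (hφ : ∀ x, ‖φ x‖ ≤ 1) (hR : ∀ x, R < |x| → φ x = 0) (p : ℝ≥0∞) :
    MemLp (modulatedTensor w φ) p volume := by
  refine ⟨(continuous_modulatedTensor w hc).aestronglyMeasurable, ?_⟩
  exact (eLpNorm_mono_real (norm_modulatedTensor_le_prod_indicator w hφ hR)).trans_lt
    (eLpNorm_prod_indicator_ne_top d R p).lt_top

theorem norm_modulatedTensor_le_one {d : ℕ} (w : Fin d → ℝ) {φ : ℝ → ℂ} (hφ : ∀ x, ‖φ x‖ ≤ 1)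
    (x : Fin d → ℝ) : ‖modulatedTensor w φ x‖ ≤ 1 := by
  rw [norm_modulatedTensor]
  exact Finset.prod_le_one (fun _ _ => norm_nonneg _) fun i _ => hφ _

theorem eLpNorm_modulatedTensor_top_le {d : ℕ} (w : Fin d → ℝ) {φ : ℝ → ℂ}
    (hφ : ∀ x, ‖φ x‖ ≤ 1) : eLpNorm (modulatedTensor w φ) ∞ volume ≤ 1 := by
  rw [eLpNorm_exponent_top]
  refine eLpNormEssSup_le_of_ae_bound (C := 1) (ae_of_all _ ?_) |>.trans_eq (by simp)
  exact norm_modulatedTensor_le_one w hφ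

/-! ### The contradiction -/

theorem exists_lt_pow_mul {x c L : ℝ≥0∞} (hx : 1 < x) (hc : c ≠ 0) (hL : L ≠ ∞) :
    ∃ n : ℕ, L < x ^ n * c := by
  have h := ENNReal.tendsto_pow_atTop_nhds_top_iff.2 hx
  obtain ⟨n, hn⟩ := (h.eventually_const_lt (ENNReal.div_lt_top hL hc)).exists
  exact ⟨n, (ENNReal.div_lt_iff (Or.inl hc) (Or.inr hL)).1 hn⟩

theorem theorem3p9 (d : ℕ) (hd : 1 < d) (p : ℝ≥0∞) (hp : 1 ≤ p) (r : ℝ) (hr : 0 < r) :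
    ¬ ∃ C : ℝ, 0 < C ∧ ∀ f g : (Fin d → ℝ) →ᵇ ℂ,
      MemBesov r p (f : (Fin d → ℝ) → ℂ) → MemBesov r p (g : (Fin d → ℝ) → ℂ) →
        besovNorm r p (fun x => f x * g x) ≤
          ENNReal.ofReal C *
            (besovNorm r p (f : (Fin d → ℝ) → ℂ) * eLpNorm (g : (Fin d → ℝ) → ℂ) ∞ volume +
              eLpNorm (f : (Fin d → ℝ) → ℂ) ∞ volume * besovNorm r p (g : (Fin d → ℝ) → ℂ)) := by
  rintro ⟨C, -, hC⟩
  -- `r < s` gives summability, `s < 2r` the final growth, and `s < ⌊r⌋₊ + 1` lets differences of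
  -- that order detect smoothness `s`.
  obtain ⟨s, hrs, hs⟩ : ∃ s, r < s ∧ s < min (2 * r) (⌊r⌋₊ + 1) :=
    exists_between (lt_min (by linarith) (Nat.lt_floor_add_one r))
  obtain ⟨hs2, hsm⟩ := lt_min_iff.1 hs
  let b : ContDiffBump (0 : ℝ) := ⟨1, 2, one_pos, one_lt_two⟩
  let φ : ℝ → ℂ := fun x => (b x : ℂ)
  have hφs : ContDiff ℝ (⊤ : ℕ∞) φ := Complex.ofRealCLM.contDiff.comp b.contDiff
  have hφ1 : ∀ x, ‖φ x‖ ≤ 1 := fun x => by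
    simpa [φ, abs_of_nonneg b.nonneg] using b.le_one
  have hφR : ∀ x, 2 < |x| → φ x = 0 := fun x hx => by
    simp only [φ, Complex.ofReal_eq_zero]
    exact b.zero_of_le_dist (by simpa using hx.le)
  obtain ⟨K, hK, hle⟩ := exists_besovNorm_modulatedTensor_le d hr hrs hsm.le hp hφs hφR
  let i : Fin d := ⟨0, by omega⟩
  let j : Fin d := ⟨1, hd⟩
  have hij : i ≠ j := by simp [i, j]
  set c := eLpNorm (fun x : Fin d → ℝ => ∏ l, b (x l) * b (x l)) p volume
  have hc : c ≠ 0 := by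
    have hcont : Continuous (fun x : Fin d → ℝ => ∏ l, b (x l) * b (x l)) :=
      continuous_finsetProd _ fun l _ => by
        have := b.continuous.comp (continuous_apply (A := fun _ : Fin d => ℝ) l)
        exact this.mul this
    intro h0
    rw [eLpNorm_eq_zero_iff hcont.aestronglyMeasurable (by positivity),
      hcont.ae_eq_iff_eq volume continuous_zero] at h0
    have hb : b 0 = 1 := b.one_of_mem_closedBall (by simp [b])
    have := congrFun h0 0
    simp [hb] at this
  -- The right-hand side without its factor `2^(s n)`; the 2 counts its two equally bounded terms.
  set L := ENNReal.ofReal C * (2 * (K * ENNReal.ofReal ((Real.pi * 2) ^ s)))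
  have hL : L ≠ ∞ := by
    refine ENNReal.mul_ne_top ENNReal.ofReal_ne_top (ENNReal.mul_ne_top (by norm_num)
      (ENNReal.mul_ne_top hK ENNReal.ofReal_ne_top))
  have hx : 1 < (2 : ℝ≥0∞) ^ (2 * r - s) := ENNReal.one_lt_rpow ENNReal.one_lt_two (by linarith)
  obtain ⟨n, hn⟩ := exists_lt_pow_mul hx hc hL
  set ω := Real.pi * 2 ^ (n + 1) with hωdef
  have hω : 1 ≤ ω :=
    one_le_mul_of_one_le_of_one_le (by linarith [Real.pi_gt_three]) (one_le_pow₀ one_le_two)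
  have hωs : ENNReal.ofReal (ω ^ s) =
      ENNReal.ofReal ((Real.pi * 2) ^ s) * (2 : ℝ≥0∞) ^ (s * n) := by
    rw [hωdef, pow_succ', ← mul_assoc, Real.mul_rpow (by positivity) (by positivity),
      ENNReal.ofReal_mul (by positivity), ← Real.rpow_natCast, ← Real.rpow_mul two_pos.le,
      ← ENNReal.ofReal_rpow_of_pos two_pos, mul_comm (n : ℝ) s]
    norm_num
  have hmem : ∀ l : Fin d, MemBesov r p (modulatedTensor (Pi.single l ω) φ) := fun l =>
    ⟨memLp_modulatedTensor _ hφs.continuous hφ1 hφR p,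
      (hle l ω hω).trans_lt (ENNReal.mul_lt_top hK.lt_top ENNReal.ofReal_lt_top)⟩
  let F : Fin d → ((Fin d → ℝ) →ᵇ ℂ) := fun l =>
    BoundedContinuousFunction.ofNormedAddCommGroup (modulatedTensor (Pi.single l ω) φ)
      (continuous_modulatedTensor _ hφs.continuous) 1 (norm_modulatedTensor_le_one _ hφ1)
  have hF := hC (F i) (F j) (hmem i) (hmem j)
  have hlow := le_besovNorm_modulatedTensor (r := r) hp (φ := fun y => b y * b y)
    (fun _ => mul_self_nonneg _) hij n (Pi.single i ω + Pi.single j ω : Fin d → ℝ)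
    (by simp [hij, hωdef]) (by simp [hij.symm, hωdef])
  have hprod : (fun x => F i x * F j x) =
      modulatedTensor (Pi.single i ω + Pi.single j ω : Fin d → ℝ)
        (fun y => ((b y * b y : ℝ) : ℂ)) := by
    funext x
    simp only [Complex.ofReal_mul]
    exact modulatedTensor_mul _ _ φ φ x
  rw [hprod] at hF
  have hup : (2 : ℝ≥0∞) ^ (r * (2 * n)) * c ≤ L * (2 : ℝ≥0∞) ^ (s * n) := by
    refine (hlow.trans hF).trans ?_
    have h1 := mul_le_mul' (hle i ω hω) (eLpNorm_modulatedTensor_top_le (Pi.single j ω) hφ1)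
    have h2 := mul_le_mul' (eLpNorm_modulatedTensor_top_le (Pi.single i ω) hφ1) (hle j ω hω)
    refine (mul_le_mul_right (add_le_add h1 h2) _).trans_eq ?_
    rw [hωs]
    ring
  have hsplit : (2 : ℝ≥0∞) ^ (r * (2 * n)) =
      (2 : ℝ≥0∞) ^ (s * n) * ((2 : ℝ≥0∞) ^ (2 * r - s)) ^ n := by
    rw [← ENNReal.rpow_natCast, ← ENNReal.rpow_mul,
      ← ENNReal.rpow_add _ _ two_ne_zero ENNReal.ofNat_ne_top]
    congr 1
    ring
  rw [hsplit, mul_assoc, mul_comm L] at hup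
  exact hn.not_ge ((ENNReal.mul_le_mul_iff_right (ENNReal.rpow_pos two_pos ENNReal.ofNat_ne_top).ne'
    (ENNReal.rpow_ne_top_of_nonneg (by have := hr.trans hrs; positivity)
      ENNReal.ofNat_ne_top)).1 hup)
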